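/- Let $c>0$. For every $n\ge 1$ let $w_{n,1},\dots,w_{n,n}$ be i.i.d. random variables with the uniform distribution $\mathrm{Unif}(-c/\sqrt n,\,c/\sqrt n)$ (the weights of one output neuron of a layer with $n$ inputs), and let $z_{n,1},\dots,z_{n,n}$ be i.i.d. random variables with the arcsine distribution $\arcsin(-1,1)$, i.e. with density $x\mapsto \frac{1}{\pi\sqrt{1-x^2}}$ on $(-1,1)$ (the activations of the previous layer), independent of the weights. Then the pre-activation $$y_n=\sum_{i=1}^n w_{n,i}\,z_{n,i}$$ converges in distribution to the Gaussian distribution $\mathcal N(0,c^2/6)$ (mean $0$, variance $c^2/6$) as $n\to\infty$. In particular, if $c=\alpha\sqrt 6$, then $y_n$ converges in distribution to $\mathcal N(0,\alpha^2)$. -/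

import Mathlib

open MeasureTheory ProbabilityTheory Filter

/-- The arcsine distribution `arcsin(-1, 1)` on the real line: the measure with density
`x ↦ 1 / (π √(1 - x ^ 2))` on the open interval `(-1, 1)` and `0` elsewhere, with respect to
Lebesgue measure. -/
noncomputable def arcsineMeasure : Measure ℝ :=
  volume.withDensity fun x : ℝ =>
    ENNReal.ofReal
      (Set.indicator (Set.Ioo (-1) 1) (fun x : ℝ => 1 / (Real.pi * Real.sqrt (1 - x ^ 2))) x)

/-!
With `r = c / √n`, a weight `w ~ Unif(-r, r)` is `r * U` in law, where `U ~ Unif(-1, 1)`. Hence each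
summand `w * z` has the law of `(c / √6) * (√n)⁻¹ * X`, where `X = √6 * U * Z` for independent
`U ~ Unif(-1, 1)` and `Z ~ arcsin(-1, 1)`. The variable `X` does not depend on `n`; it is centred
because `U` is, and it has variance `6 * 𝔼[U ^ 2] * 𝔼[Z ^ 2] = 6 * (1 / 3) * (1 / 2) = 1`. The second
moment of `Z` is read off from `Z = sin Θ` with `Θ ~ Unif(-π / 2, π / 2)`.

The products `w i * z i` are independent because the pairs `(w i, z i)` are
(`iIndepFun_prodMk_of_iIndepFun_sumElim`), so the characteristic function of the pre-activation at
`t` is `φ ((√n)⁻¹ * (c / √6 * t)) ^ n`, with `φ` that of `X`. The second-order expansion of `φ` at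
`0` (`tendsto_charFun_inv_sqrt_mul_pow`) gives the limit `exp (-(c ^ 2 / 6) * t ^ 2 / 2)`, and
Lévy's convergence theorem concludes. Working with characteristic functions avoids having to
realise the triangular array on one probability space.
-/

/-- If `X₁, …, Xₙ, Y₁, …, Yₙ` are mutually independent, then so are the pairs `(Xᵢ, Yᵢ)`. -/
lemma iIndepFun_prodMk_of_iIndepFun_sumElim {ι Ω α : Type*} [Fintype ι] [MeasurableSpace Ω]
    [MeasurableSpace α] {P : Measure Ω} [IsProbabilityMeasure P] {X Y : ι → Ω → α}
    (hX : ∀ i, AEMeasurable (X i) P) (hY : ∀ i, AEMeasurable (Y i) P)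
    (h : iIndepFun (fun k : ι ⊕ ι => Sum.elim X Y k) P) :
    iIndepFun (fun i ω => (X i ω, Y i ω)) P := by
  have hXY : ∀ k : ι ⊕ ι, AEMeasurable (Sum.elim X Y k) P := by
    rintro (i | i)
    exacts [hX i, hY i]
  have _ : ∀ i, IsProbabilityMeasure (P.map (X i)) :=
    fun i => Measure.isProbabilityMeasure_map (hX i)
  have _ : ∀ i, IsProbabilityMeasure (P.map (Y i)) :=
    fun i => Measure.isProbabilityMeasure_map (hY i)
  have _ : ∀ k, IsProbabilityMeasure (P.map (Sum.elim X Y k)) :=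
    fun k => Measure.isProbabilityMeasure_map (hXY k)
  have hpair : ∀ i, P.map (fun ω => (X i ω, Y i ω)) = (P.map (X i)).prod (P.map (Y i)) := fun i =>
    (indepFun_iff_map_prod_eq_prod_map_map (hX i) (hY i)).1
      (h.indepFun (i := Sum.inl i) (j := Sum.inr i) (by simp))
  rw [iIndepFun_iff_map_fun_eq_pi_map (fun i => (hX i).prodMk (hY i))]
  simp_rw [hpair]
  -- Regroup the coordinates: `ι ⊕ ι → α` is `(ι → α) × (ι → α)`, which is `ι → α × α`.
  have h1 := (measurePreserving_sumPiEquivProdPi fun k => P.map (Sum.elim X Y k)).map_eq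
  have h2 := (measurePreserving_arrowProdEquivProdArrow α α ι (fun i => P.map (X i))
    (fun i => P.map (Y i))).symm.map_eq
  rw [← h2]
  have h3 := (iIndepFun_iff_map_fun_eq_pi_map hXY).1 h
  rw [← h3] at h1
  simp only [Sum.elim_inl, Sum.elim_inr] at h1
  rw [← h1, AEMeasurable.map_map_of_aemeasurable (by fun_prop) (by fun_prop),
    AEMeasurable.map_map_of_aemeasurable (by fun_prop) (by fun_prop)]
  rfl

/-- The uniform distribution on `(-r, r)` is the uniform distribution on `(-1, 1)` scaled by `r`. -/
lemma cond_Ioo_eq_map_mul {r : ℝ} (hr : 0 < r) :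
    cond volume (Set.Ioo (-r) r) = (cond volume (Set.Ioo (-1 : ℝ) 1)).map (r * ·) := by
  have hpre : (r * ·) ⁻¹' Set.Ioo (-r) r = Set.Ioo (-1 : ℝ) 1 := by
    ext x
    simp only [Set.mem_preimage, Set.mem_Ioo]
    constructor <;> rintro ⟨h1, h2⟩ <;> constructor <;> nlinarith
  have hr' : ENNReal.ofReal |r⁻¹| ≠ 0 := by simp [hr.ne']
  ext A hA
  rw [Measure.map_apply (by fun_prop) hA, cond_apply measurableSet_Ioo,
    cond_apply measurableSet_Ioo, ← hpre, ← Set.preimage_inter, Real.volume_preimage_mul_left hr.ne',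
    Real.volume_preimage_mul_left hr.ne', ENNReal.mul_inv (by simp [hr.ne']) (by simp [hr.ne'])]
  rw [mul_mul_mul_comm, ENNReal.inv_mul_cancel hr' ENNReal.ofReal_ne_top, one_mul]

/-- The arcsine distribution is the law of `sin Θ` for `Θ` uniform on `(-π / 2, π / 2)`: under
`x = sin θ` the factor `√(1 - x ^ 2)` in the density cancels against the derivative `cos θ`. -/
lemma arcsineMeasure_eq_map_sin :
    arcsineMeasure = (cond volume (Set.Ioo (-(Real.pi / 2)) (Real.pi / 2))).map Real.sin := by
  have himage : Real.sin '' Set.Ioo (-(Real.pi / 2)) (Real.pi / 2) = Set.Ioo (-1) 1 := by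
    apply Set.Subset.antisymm
    · rintro _ ⟨x, hx, rfl⟩
      have := Real.cos_pos_of_mem_Ioo hx
      have := Real.sin_sq_add_cos_sq x
      constructor <;> nlinarith
    · intro y hy
      exact ⟨Real.arcsin y,
        ⟨Real.neg_pi_div_two_lt_arcsin.2 hy.1, Real.arcsin_lt_pi_div_two.2 hy.2⟩,
        Real.sin_arcsin hy.1.le hy.2.le⟩
  refine Measure.ext_of_lintegral _ fun f hf => ?_
  rw [lintegral_map hf Real.measurable_sin, ProbabilityTheory.cond, lintegral_smul_measure,
    arcsineMeasure,
    lintegral_withDensity_eq_lintegral_mul _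
      ((Measurable.indicator (by fun_prop) measurableSet_Ioo).ennreal_ofReal) hf]
  have hdensity : ∀ x : ℝ, (((fun x : ℝ => ENNReal.ofReal (Set.indicator (Set.Ioo (-1) 1)
      (fun x : ℝ => 1 / (Real.pi * √(1 - x ^ 2))) x)) * f) x) = (Set.Ioo (-1 : ℝ) 1).indicator
      (fun x => ENNReal.ofReal (1 / (Real.pi * √(1 - x ^ 2))) * f x) x := by
    intro x
    by_cases hx : x ∈ Set.Ioo (-1 : ℝ) 1 <;>
      simp only [Pi.mul_apply, Set.indicator_of_mem, Set.indicator_of_notMem, hx,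
        not_false_eq_true, ENNReal.ofReal_zero, zero_mul]
  simp_rw [hdensity]
  rw [lintegral_indicator measurableSet_Ioo, ← himage,
    lintegral_image_eq_lintegral_abs_deriv_mul measurableSet_Ioo
      (fun x _ => (Real.hasDerivAt_sin x).hasDerivWithinAt)
      (Real.injOn_sin.mono Set.Ioo_subset_Icc_self), smul_eq_mul,
    ← lintegral_const_mul _ (by fun_prop)]
  refine setLIntegral_congr_fun measurableSet_Ioo fun x hx => ?_
  have hc := Real.cos_pos_of_mem_Ioo hx
  rw [← mul_assoc, ← ENNReal.ofReal_mul (abs_nonneg _), Real.volume_Ioo, ← Real.cos_sq',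
    Real.sqrt_sq hc.le, abs_of_pos hc, ← ENNReal.ofReal_inv_of_pos (by linarith [Real.pi_pos])]
  congr 2
  field_simp
  ring

lemma isProbabilityMeasure_cond_Ioo {a b : ℝ} (hab : a < b) :
    IsProbabilityMeasure (cond volume (Set.Ioo a b)) :=
  cond_isProbabilityMeasure_of_finite (by simpa using hab) (by simp)

lemma integral_cond_Ioo {a b : ℝ} (hab : a ≤ b) (f : ℝ → ℝ) :
    ∫ x, f x ∂(cond volume (Set.Ioo a b)) = (b - a)⁻¹ * ∫ x in a..b, f x := by
  rw [ProbabilityTheory.cond, integral_smul_measure, intervalIntegral.integral_of_le hab,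
    integral_Ioc_eq_integral_Ioo, Real.volume_Ioo, ENNReal.toReal_inv,
    ENNReal.toReal_ofReal (sub_nonneg.2 hab), smul_eq_mul]

instance : IsProbabilityMeasure arcsineMeasure := by
  have := isProbabilityMeasure_cond_Ioo (neg_lt_self (half_pos Real.pi_pos))
  rw [arcsineMeasure_eq_map_sin]
  exact Measure.isProbabilityMeasure_map (by fun_prop)

lemma integral_sq_arcsineMeasure : ∫ x, x ^ 2 ∂arcsineMeasure = 1 / 2 := by
  rw [arcsineMeasure_eq_map_sin, integral_map (by fun_prop) (by fun_prop),
    integral_cond_Ioo (by linarith [Real.pi_pos]), integral_sin_sq]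
  simp
  field_simp

/-- The joint law of a `Unif(-1, 1)` variable and an independent `arcsin(-1, 1)` variable. -/
noncomputable def uniformProdArcsine : Measure (ℝ × ℝ) :=
  (cond volume (Set.Ioo (-1 : ℝ) 1)).prod arcsineMeasure

instance : IsProbabilityMeasure uniformProdArcsine := by
  have := isProbabilityMeasure_cond_Ioo (show (-1 : ℝ) < 1 by norm_num)
  unfold uniformProdArcsine
  infer_instance

/-- The product of the two coordinates, scaled by `√6` so as to have variance `1` under
`uniformProdArcsine`. -/
noncomputable def normalizedProduct (p : ℝ × ℝ) : ℝ := √6 * (p.1 * p.2)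

@[fun_prop]
lemma measurable_normalizedProduct : Measurable normalizedProduct := by
  unfold normalizedProduct
  fun_prop

lemma integral_normalizedProduct : uniformProdArcsine[normalizedProduct] = 0 := by
  have h := integral_prod_mul (μ := cond volume (Set.Ioo (-1 : ℝ) 1)) (ν := arcsineMeasure)
    (fun x : ℝ => x) (fun x : ℝ => x)
  rw [integral_cond_Ioo (by norm_num) (fun x => x)] at h
  simp only [uniformProdArcsine, normalizedProduct, integral_const_mul, h]
  simp

lemma integral_normalizedProduct_sq : uniformProdArcsine[normalizedProduct ^ 2] = 1 := by
  have h := integral_prod_mul (μ := cond volume (Set.Ioo (-1 : ℝ) 1)) (ν := arcsineMeasure)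
    (fun x : ℝ => x ^ 2) (fun x : ℝ => x ^ 2)
  rw [integral_cond_Ioo (by norm_num), integral_sq_arcsineMeasure] at h
  simp only [uniformProdArcsine, normalizedProduct, Pi.pow_apply, mul_pow, integral_const_mul, h]
  norm_num

/-- If `W ~ Unif(-r, r)` and `Z ~ arcsin(-1, 1)` are independent, then `W * Z` has the law of
`r / √6` times the normalized product. -/
lemma map_mul_eq_of_isUniform_of_hasLaw_arcsine {Ω : Type*} [MeasurableSpace Ω] {P : Measure Ω}
    [IsProbabilityMeasure P] {r : ℝ} (hr : 0 < r) {W Z : Ω → ℝ} (hWm : AEMeasurable W P)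
    (hW : pdf.IsUniform W (Set.Ioo (-r) r) P volume)
    (hZ : HasLaw Z arcsineMeasure P) (hWZ : IndepFun W Z P) :
    P.map (fun ω => W ω * Z ω) =
      uniformProdArcsine.map fun p => r / √6 * normalizedProduct p := by
  have := isProbabilityMeasure_cond_Ioo (show (-1 : ℝ) < 1 by norm_num)
  have h := (indepFun_iff_map_prod_eq_prod_map_map hWm hZ.aemeasurable).1 hWZ
  rw [hZ.map_eq, show P.map W = _ from hW, cond_Ioo_eq_map_mul hr] at h
  calc P.map (fun ω => W ω * Z ω)
      = (P.map fun ω => (W ω, Z ω)).map (fun p => p.1 * p.2) := by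
        rw [AEMeasurable.map_map_of_aemeasurable (by fun_prop) (hWm.prodMk hZ.aemeasurable)]
        rfl
    _ = (uniformProdArcsine.map (Prod.map (r * ·) id)).map (fun p => p.1 * p.2) := by
        rw [h, uniformProdArcsine, ← Measure.map_prod_map _ _ (by fun_prop) measurable_id,
          Measure.map_id]
    _ = uniformProdArcsine.map fun p => r / √6 * normalizedProduct p := by
        rw [Measure.map_map (by fun_prop) (by fun_prop)]
        congr 1
        ext p
        simp [normalizedProduct]
        field_simp

/-- For every width `n`, `w n i` and `z n i` (`i < n`) are the weights of one output neuron and the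
activations of the previous layer, and `∑ i, w n i * z n i` is the pre-activation of that neuron.
For each `n` the `2 n` variables are mutually independent; nothing is assumed about the joint law
for different `n`, so each width may live on its own probability space. -/
theorem lemmaA1
    {Ω : ℕ → Type*} [mΩ : ∀ n, MeasurableSpace (Ω n)]
    (P : ∀ n, Measure (Ω n)) [∀ n, IsProbabilityMeasure (P n)]
    (c : ℝ) (hc : 0 < c)
    (w z : ∀ n : ℕ, Fin n → Ω n → ℝ)
    (hw : ∀ (n : ℕ) (i : Fin n),
      pdf.IsUniform (w n i) (Set.Ioo (-(c / Real.sqrt n)) (c / Real.sqrt n)) (P n) volume)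
    (hz : ∀ (n : ℕ) (i : Fin n), HasLaw (z n i) arcsineMeasure (P n))
    (hindep : ∀ n : ℕ,
      iIndepFun (fun k : Fin n ⊕ Fin n => Sum.elim (w n) (z n) k) (P n)) :
    TendstoInDistribution (fun (n : ℕ) (ω : Ω n) => ∑ i : Fin n, w n i ω * z n i ω) atTop
        (id : ℝ → ℝ) P (gaussianReal 0 (Real.toNNReal (c ^ 2 / 6))) ∧
      ∀ α : ℝ, c = α * Real.sqrt 6 →
        TendstoInDistribution (fun (n : ℕ) (ω : Ω n) => ∑ i : Fin n, w n i ω * z n i ω) atTop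
          (id : ℝ → ℝ) P (gaussianReal 0 (Real.toNNReal (α ^ 2))) := by
  -- An index `i : Fin n` forces `0 < n`: for `n = 0` the interval is empty and the sum is `0`.
  have hr : ∀ n, Fin n → 0 < c / √n := fun n i =>
    div_pos hc (Real.sqrt_pos.2 (Nat.cast_pos.2 i.pos))
  have hwm : ∀ n i, AEMeasurable (w n i) (P n) := fun n i =>
    (hw n i).aemeasurable (by simpa using hr n i) (by simp)
  have hzm : ∀ n i, AEMeasurable (z n i) (P n) := fun n i => (hz n i).aemeasurable
  have hm : ∀ n i, AEMeasurable (fun ω => w n i ω * z n i ω) (P n) :=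
    fun n i => (hwm n i).mul (hzm n i)
  have hchar : ∀ (n : ℕ) (t : ℝ),
      charFun ((P n).map fun ω => ∑ i : Fin n, w n i ω * z n i ω) t =
        charFun (uniformProdArcsine.map normalizedProduct) ((√n)⁻¹ * (c / √6 * t)) ^ n := by
    intro n t
    have hprod : iIndepFun (fun i ω => w n i ω * z n i ω) (P n) :=
      (iIndepFun_prodMk_of_iIndepFun_sumElim (hwm n) (hzm n) (hindep n)).comp
        (fun _ p => p.1 * p.2) (fun _ => by fun_prop)
    have hfactor : ∀ i, charFun ((P n).map fun ω => w n i ω * z n i ω) t =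
        charFun (uniformProdArcsine.map normalizedProduct) ((√n)⁻¹ * (c / √6 * t)) := by
      intro i
      have hWZ : IndepFun (w n i) (z n i) (P n) :=
        (hindep n).indepFun (i := Sum.inl i) (j := Sum.inr i) (by simp)
      rw [map_mul_eq_of_isUniform_of_hasLaw_arcsine (hr n i) (hwm n i) (hw n i) (hz n i) hWZ,
        charFun_map_mul_comp (by fun_prop)]
      congr 1
      ring
    rw [hprod.charFun_map_fun_sum_eq_prod (hm n), Finset.prod_apply]
    simp [hfactor]
  have hlim : TendstoInDistribution (fun (n : ℕ) (ω : Ω n) => ∑ i : Fin n, w n i ω * z n i ω) atTop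
      (id : ℝ → ℝ) P (gaussianReal 0 (Real.toNNReal (c ^ 2 / 6))) := by
    refine ⟨fun n => Finset.aemeasurable_fun_sum _ fun i _ => hm n i, by fun_prop, ?_⟩
    refine ProbabilityMeasure.tendsto_iff_tendsto_charFun.2 fun t => ?_
    simp only [ProbabilityMeasure.coe_mk, hchar, Measure.map_id, charFun_gaussianReal]
    convert! tendsto_charFun_inv_sqrt_mul_pow (X := normalizedProduct) (P := uniformProdArcsine)
      (by fun_prop) integral_normalizedProduct integral_normalizedProduct_sq (c / √6 * t) using 3
    have h6 : ((√6 : ℝ) : ℂ) ^ 2 = 6 := by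
      norm_cast
      norm_num
    rw [Real.coe_toNNReal _ (by positivity)]
    push_cast
    rw [mul_pow, div_pow, h6]
    ring
  refine ⟨hlim, fun α hα => ?_⟩
  have hvar : α ^ 2 = c ^ 2 / 6 := by
    rw [hα, mul_pow, Real.sq_sqrt (by norm_num)]
    ring
  rwa [hvar]
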